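/- **Operators.** Let $\mathcal A$ be a commutative Hausdorff topological $\mathbb Q$-algebra with a derivation $D$. A formal operator is a series $A=\sum_{i\in\mathbb Z}f_iD^i$, $f_i\in\mathcal A$; put $A_+=\sum_{i\ge0}f_iD^i$, $A_-=\sum_{i<0}f_iD^i$, $A^*=\sum_i(-D)^i f_i$; products follow $D^i f=\sum_{r\ge0}\binom ir D^r(f)D^{i-r}$. A *ring of operators* is an additive group of formal operators, containing all $D^i$ and stable under $A\mapsto A_\pm$, on which all products converge coefficientwise (as unconditional sums in $\mathcal A$), stay in the group, and are associative. Fix two rings of operators $\mathcal D^-$ and $\mathcal D^+$ with $(\mathcal D^-)_+\subset\mathcal D^+$ and $(\mathcal D^+)_-\subset\mathcal D^-$. Let $t_k,\hat t_k\in\mathcal A$ ($k$ odd positive), $t_1=x$, be the time variables, with pairwise commuting derivations $\partial_{t_k},\partial_{\hat t_k}$ of $\mathcal A$ for which the times are independent coordinates, and $\partial_{t_1}=D$. Derivations of $\mathcal A$ act on operators coefficientwise. **Hierarchy.** Let $n\ge2$. Let $\Phi=1+\sum_{i\ge1}a_iD^{-i}$ be invertible in $\mathcal D^-$ and $\hat\Phi=1+\sum_{i\ge1}b_iD^i$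 be invertible in $\mathcal D^+$, with $\Phi^*=D\Phi^{-1}D^{-1}$ and $\hat\Phi^*=D\hat\Phi^{-1}D^{-1}$. Put $L=\Phi D\Phi^{-1}$, $\hat L=\hat\Phi D^{-1}\hat\Phi^{-1}$. Suppose that they solve the D-type Drinfeld–Sokolov hierarchy, that is, the two-component BKP hierarchy $$\partial_{t_k}\Phi=-(L^k)_-\Phi,\quad \partial_{t_k}\hat\Phi=\bigl((L^k)_+-\delta_{k1}\hat L^{-1}\bigr)\hat\Phi,\quad \partial_{\hat t_k}\Phi=-(\hat L^k)_-\Phi,\quad \partial_{\hat t_k}\hat\Phi=(\hat L^k)_+\hat\Phi\qquad(k\text{ odd positive})$$ with the reduction $\mathcal L:=L^{2n}=\hat L^2$. Assume that $$\Gamma_L=\sum_{k\text{ odd}>0}\tfrac{k}{2n}t_kD^{k-2n}\in\mathcal D^-,\qquad \hat\Gamma_R=-\tfrac x2D^3-\tfrac12\sum_{k\text{ odd}>0}k\hat t_kD^{2-k}\in\mathcal D^+,$$ and put $\mathcal M=\Phi\Gamma_L\Phi^{-1}$, $\hat{\mathcal M}=\hat\Phi\hat\Gamma_R\hat\Phi^{-1}$,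 and $\mathcal B_{m,l}=(\mathcal M-\hat{\mathcal M})^m\mathcal L^l$ for $m$ odd positive and $l\ge0$. **Additional flows.** The flow $\partial_{c_{m,l}}$ is a continuous derivation of $\mathcal A$ that commutes with $D$, annihilates all times, preserves $\mathcal D^\pm$, and satisfies $$\partial_{c_{m,l}}\Phi=-(\mathcal B_{m,l})_-\Phi,\qquad \partial_{c_{m,l}}\hat\Phi=(\mathcal B_{m,l})_+\hat\Phi .$$ **Theorem.** Let $m,s$ be odd positive integers and $k,l\ge0$. If $(m,s)\neq(1,1)$, assume that the products mixing $\mathcal M$ and $\hat{\mathcal M}$ are defined, i.e. $\mathcal L,\mathcal M,\hat{\mathcal M}$ lie in a common ring of operators $R$ with $R_-\subset\mathcal D^-$ and $R_+\subset\mathcal D^+$ (for $m=s=1$ no such assumption is made). Let $\partial_{c_{m,l}}$, $\partial_{c_{s,k}}$ and (if $k+l\ge1$) $\partial_{c_{m+s-1,k+l-1}}$ be the corresponding flows. Then $\partial_{c_{m,l}}\mathcal L=[-(\mathcal B_{m,l})_-,\mathcal L]$, and the Block algebra relation $$[\partial_{c_{m,l}},\partial_{c_{s,k}}]=(km-sl)\,\partial_{c_{m+s-1,k+l-1}}$$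 holds when acting on $\Phi$, on $\hat\Phi$ and on $\mathcal L$ (for $k=l=0$ the right-hand side is $0$). -/

import Mathlib

noncomputable section

namespace DrinfeldSokolov

/-- Formal operators `∑_{i ∈ ℤ} f_i D^i`, given by their coefficients (written on the left). -/
abbrev Op (A : Type*) : Type _ := ℤ → A

section Operators

variable {A : Type*} [CommRing A] [Algebra ℚ A]

/-- The operator `D^i`. -/
def dpow (A : Type*) [CommRing A] (i : ℤ) : Op A := Pi.single i 1

/-- The nonnegative projection `A_+`. -/
def pos (P : Op A) : Op A := fun i => if 0 ≤ i then P i else 0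

/-- The negative projection `A_-`. -/
def neg (P : Op A) : Op A := fun i => if i < 0 then P i else 0

/-- A derivation of the coefficients acts on operators coefficientwise. -/
def act (δ : Derivation ℚ A A) (P : Op A) : Op A := fun i => δ (P i)

/-- The contributions to the coefficient of `D^k` in the product of `P = ∑ f_i D^i` and
`Q = ∑ g_j D^j`, by `D^i · g = ∑_{r ≥ 0} binom(i, r) D^r(g) D^{i-r}`: the pair `(i, r)` contributes
`binom(i, r) f_i D^r(g_j)` with `i + j - r = k`. -/
def leibnizTerm (D : Derivation ℚ A A) (P Q : Op A) (k : ℤ) (p : ℤ × ℕ) : A :=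
  Ring.choose p.1 p.2 • (P p.1 * (⇑D)^[p.2] (Q (k - p.1 + p.2)))

variable [TopologicalSpace A]

/-- The product of two operators (meaningful where the sums converge). -/
def mul (D : Derivation ℚ A A) (P Q : Op A) : Op A := fun k => ∑' p, leibnizTerm D P Q k p

/-- Powers of an operator. -/
def pow (D : Derivation ℚ A A) (P : Op A) : ℕ → Op A
  | 0 => dpow A 0
  | j + 1 => mul D (pow D P j) P

/-- The commutator of two operators. -/
def comm (D : Derivation ℚ A A) (P Q : Op A) : Op A := mul D P Q - mul D Q P

/-- `Q` is the formal adjoint `∑_i (-D)^i · f_i` of `P = ∑_i f_i D^i`: the coefficient of `D^k` is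
`∑_{r ≥ 0} (-1)^{k+r} binom(k+r, r) D^r(f_{k+r})`. -/
def IsAdjoint (D : Derivation ℚ A A) (P Q : Op A) : Prop :=
  ∀ k : ℤ, HasSum (fun r : ℕ =>
    ((k + r).negOnePow : ℤ) • (Ring.choose (k + r) r • (⇑D)^[r] (P (k + r)))) (Q k)

/-- A ring of formal operators: a group of formal operators that contains the powers of `D`, is
stable under the projections, and on which the Leibniz product converges coefficientwise, stays
inside, and is associative. -/
structure OperatorRing (D : Derivation ℚ A A) where
  carrier : AddSubgroup (Op A)
  dpow_mem : ∀ i, dpow A i ∈ carrier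
  pos_mem : ∀ P ∈ carrier, pos P ∈ carrier
  neg_mem : ∀ P ∈ carrier, neg P ∈ carrier
  summable : ∀ P ∈ carrier, ∀ Q ∈ carrier, ∀ k, Summable (leibnizTerm D P Q k)
  mul_mem : ∀ P ∈ carrier, ∀ Q ∈ carrier, mul D P Q ∈ carrier
  mul_assoc : ∀ P ∈ carrier, ∀ Q ∈ carrier, ∀ R ∈ carrier,
    mul D (mul D P Q) R = mul D P (mul D Q R)

/-- `Γ_L = ∑_{k odd, k > 0} (k / 2n) t_k D^{k-2n}`. -/
def gammaL (n : ℕ) (t : ℕ → A) : Op A := fun i =>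
  if Odd i ∧ 0 < i + 2 * n then
    (((i + 2 * n : ℤ) : ℚ) / (2 * n)) • t (i + 2 * n).toNat
  else 0

/-- `Γ̂_R = -(x/2) D^3 - (1/2) ∑_{k odd, k > 0} k t̂_k D^{2-k}`. -/
def gammaR (x : A) (th : ℕ → A) : Op A := fun i =>
  if i = 3 then -((1 / 2 : ℚ) • x)
  else if Odd i ∧ 0 < 2 - i then -((((2 - i : ℤ) : ℚ) / 2) • th (2 - i).toNat)
  else 0

end Operators

/-- The coefficient algebra with its `x`-derivation `D`, the times `t_k`, `t̂_k` (only odd indices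
matter, and `t_1 = x`), the derivations `∂/∂t_k`, `∂/∂t̂_k`, and the two rings of formal operators:
`minus`, in which `Φ` lives, and `plus`, in which `Φ̂` lives. -/
structure Setting (A : Type*) [CommRing A] [Algebra ℚ A] [TopologicalSpace A] where
  D : Derivation ℚ A A
  t : ℕ → A
  th : ℕ → A
  dt : ℕ → Derivation ℚ A A
  dth : ℕ → Derivation ℚ A A
  dt_t : ∀ j k, Odd j → Odd k → dt j (t k) = if j = k then 1 else 0
  dt_th : ∀ j k, Odd j → Odd k → dt j (th k) = 0
  dth_t : ∀ j k, Odd j → Odd k → dth j (t k) = 0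
  dth_th : ∀ j k, Odd j → Odd k → dth j (th k) = if j = k then 1 else 0
  dt_dt : ∀ j k, Odd j → Odd k → ∀ f, dt j (dt k f) = dt k (dt j f)
  dt_dth : ∀ j k, Odd j → Odd k → ∀ f, dt j (dth k f) = dth k (dt j f)
  dth_dth : ∀ j k, Odd j → Odd k → ∀ f, dth j (dth k f) = dth k (dth j f)
  dt_one : dt 1 = D
  minus : OperatorRing D
  plus : OperatorRing D
  pos_minus : ∀ P ∈ minus.carrier, pos P ∈ plus.carrier
  neg_plus : ∀ P ∈ plus.carrier, neg P ∈ minus.carrier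

variable {A : Type*} [CommRing A] [Algebra ℚ A] [TopologicalSpace A]

/-- A pair of dressing operators `Φ = 1 + ∑_{i ≥ 1} a_i D^{-i}`, `Φ̂ = 1 + ∑_{i ≥ 1} b_i D^i` of
B type, with their inverses. -/
structure Dressing (S : Setting A) where
  Φ : Op A
  Φinv : Op A
  Φh : Op A
  Φhinv : Op A
  Φ_mem : Φ ∈ S.minus.carrier
  Φinv_mem : Φinv ∈ S.minus.carrier
  Φh_mem : Φh ∈ S.plus.carrier
  Φhinv_mem : Φhinv ∈ S.plus.carrier
  Φ_zero : Φ 0 = 1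
  Φ_pos : ∀ i, 0 < i → Φ i = 0
  Φh_zero : Φh 0 = 1
  Φh_neg : ∀ i, i < 0 → Φh i = 0
  Φ_mul_inv : mul S.D Φ Φinv = dpow A 0
  Φ_inv_mul : mul S.D Φinv Φ = dpow A 0
  Φh_mul_inv : mul S.D Φh Φhinv = dpow A 0
  Φh_inv_mul : mul S.D Φhinv Φh = dpow A 0
  Φ_adjoint : IsAdjoint S.D Φ (mul S.D (mul S.D (dpow A 1) Φinv) (dpow A (-1)))
  Φh_adjoint : IsAdjoint S.D Φh (mul S.D (mul S.D (dpow A 1) Φhinv) (dpow A (-1)))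

namespace Dressing

variable {S : Setting A} (W : Dressing S)

/-- `L = Φ D Φ⁻¹`. -/
def L : Op A := mul S.D (mul S.D W.Φ (dpow A 1)) W.Φinv

/-- `L̂ = Φ̂ D⁻¹ Φ̂⁻¹`. -/
def Lh : Op A := mul S.D (mul S.D W.Φh (dpow A (-1))) W.Φhinv

/-- `L̂⁻¹ = Φ̂ D Φ̂⁻¹`. -/
def Lhinv : Op A := mul S.D (mul S.D W.Φh (dpow A 1)) W.Φhinv

/-- The Lax operator `𝓛 = L^{2n}` of the reduced hierarchy. -/
def Lax (n : ℕ) : Op A := pow S.D W.L (2 * n)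

/-- The Orlov–Schulman operator `𝓜 = Φ Γ_L Φ⁻¹`. -/
def M (n : ℕ) : Op A := mul S.D (mul S.D W.Φ (gammaL n S.t)) W.Φinv

/-- The Orlov–Schulman operator `𝓜̂ = Φ̂ Γ̂_R Φ̂⁻¹`, with `x = t_1`. -/
def Mh : Op A := mul S.D (mul S.D W.Φh (gammaR (S.t 1) S.th)) W.Φhinv

/-- `𝓑_{m,l} = (𝓜 - 𝓜̂)^m 𝓛^l`. -/
def B (n m l : ℕ) : Op A := mul S.D (pow S.D (W.M n - W.Mh) m) (pow S.D (W.Lax n) l)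

/-- The dressing operators solve the two-component BKP hierarchy. -/
structure SolvesBKP : Prop where
  dt_Φ : ∀ k, Odd k → act (S.dt k) W.Φ = -mul S.D (neg (pow S.D W.L k)) W.Φ
  dt_Φh : ∀ k, Odd k → act (S.dt k) W.Φh =
    mul S.D (pos (pow S.D W.L k) - if k = 1 then W.Lhinv else 0) W.Φh
  dth_Φ : ∀ k, Odd k → act (S.dth k) W.Φ = -mul S.D (neg (pow S.D W.Lh k)) W.Φ
  dth_Φh : ∀ k, Odd k → act (S.dth k) W.Φh = mul S.D (pos (pow S.D W.Lh k)) W.Φh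

/-- The dressing operators solve the D-type Drinfeld–Sokolov hierarchy, that is, the two-component
BKP hierarchy reduced by `L^{2n} = L̂^2`. The last two conditions say that the Orlov–Schulman
operators are defined. -/
structure SolvesDS (n : ℕ) : Prop extends W.SolvesBKP where
  constraint : pow S.D W.L (2 * n) = pow S.D W.Lh 2
  gammaL_mem : gammaL n S.t ∈ S.minus.carrier
  gammaR_mem : gammaR (S.t 1) S.th ∈ S.plus.carrier

/-- `δ` is the additional flow `∂/∂c_{m,l}`: a continuous derivation of the coefficients that
commutes with `D`, does not act on the times, respects the two rings of operators, and satisfies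
`δ Φ = -(𝓑_{m,l})_- Φ` and `δ Φ̂ = (𝓑_{m,l})_+ Φ̂`. -/
structure IsBlockFlow (n m l : ℕ) (δ : Derivation ℚ A A) : Prop where
  continuous : Continuous δ
  comm_D : ∀ f, δ (S.D f) = S.D (δ f)
  apply_t : ∀ k, Odd k → δ (S.t k) = 0
  apply_th : ∀ k, Odd k → δ (S.th k) = 0
  act_minus : ∀ P ∈ S.minus.carrier, act δ P ∈ S.minus.carrier
  act_plus : ∀ P ∈ S.plus.carrier, act δ P ∈ S.plus.carrier
  act_Φ : act δ W.Φ = -mul S.D (neg (W.B n m l)) W.Φ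
  act_Φh : act δ W.Φh = mul S.D (pos (W.B n m l)) W.Φh

/-- Products that mix `𝓜` and `𝓜̂` are defined: both, and `𝓛`, lie in a common ring of formal
operators, whose negative parts can be composed with `Φ` and whose nonnegative parts can be composed
with `Φ̂`. -/
def MixedProductsDefined (n : ℕ) : Prop :=
  ∃ R : OperatorRing S.D,
    W.Lax n ∈ R.carrier ∧ W.M n ∈ R.carrier ∧ W.Mh ∈ R.carrier ∧
    (∀ P ∈ R.carrier, neg P ∈ S.minus.carrier) ∧ (∀ P ∈ R.carrier, pos P ∈ S.plus.carrier)

end Dressing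

end DrinfeldSokolov

end

noncomputable section

/-! Write `Λ` for 𝓛. The Block relation on the dressing operators reduces to one zero-curvature
equation, `δ₁B₂ - δ₂B₁ = [B₂₋, B₁₋] - [B₂₊, B₁₊] + c B₃` (`ZeroCurvature`). Brackets of negative
operators are negative and brackets of nonnegative ones nonnegative, so its negative part gives
`[δ₁, δ₂]` on `Φ` and its nonnegative part gives it on `Φ̂` (`commutator_Φ`, `commutator_Φh`).

The equation rests on canonical pairs. Dressing `[D^{2n}, Γ_L] = 1` and `[D^{-2}, Γ̂_R] = 1` gives
`[Λ, 𝓜] = [Λ, 𝓜̂] = 1`. If mixed products exist, `ν = 𝓜 - 𝓜̂` commutes with `Λ`, and all generators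
`ν^m Λ^l` commute with each other. The flow of `B` moves `Λ` and `𝓜` by `[-B₋, ·]` and `𝓜̂` by `[B₊,
·]`, hence `ν` by `[-B₋, ν] - [B, 𝓜̂]`. After antisymmetrization the first terms, by `[B₁, B₂] = 0`,
become the brackets of the parts. In the second terms a double derivative of powers of `ν` is
symmetric in the two flows and cancels (`powDeriv_comm`). What survives comes from `[Λ^l, 𝓜̂] = l
Λ^{l-1}` and has coefficient `km - sl` (`powDeriv_block`).

For `m = s = 1` no product of `𝓜` with `𝓜̂` is available. The families `𝓜Λ^j` and `𝓜̂Λ^j` then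
satisfy Witt-type relations, each in its own ring, and the leftover brackets of the two computations
cancel (`zeroCurvature_linear`).

The relation on `𝓛` follows from that on `Φ`: `[δ₁, δ₂] - c δ₃` is a derivation that kills `Φ`,
hence kills its conjugate `𝓛`. -/

namespace DrinfeldSokolov

/-! ### Noncommutative identities for derivatives of powers -/

section RingIdentities

variable {T : Type*} [Ring T]

/-- The sum `∑_{i < s} x^i c x^{s-1-i}`, the derivative of `x^s` in the direction `c`. -/
def powDeriv (x c : T) : ℕ → T
  | 0 => 0
  | s + 1 => powDeriv x c s * x + x ^ s * c

lemma powDeriv_add (x c d : T) (s : ℕ) :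
    powDeriv x (c + d) s = powDeriv x c s + powDeriv x d s := by
  induction s with
  | zero => simp [powDeriv]
  | succ s ih => simp only [powDeriv, ih]; noncomm_ring

lemma powDeriv_neg (x c : T) (s : ℕ) : powDeriv x (-c) s = -powDeriv x c s := by
  induction s with
  | zero => simp [powDeriv]
  | succ s ih => simp only [powDeriv, ih]; noncomm_ring

/-- The inner derivation `[·, g]` obeys the Leibniz rule; equivalently, the sum telescopes. -/
lemma powDeriv_commutator (x g : T) (s : ℕ) :
    powDeriv x (x * g - g * x) s = x ^ s * g - g * x ^ s := by
  induction s with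
  | zero => simp [powDeriv]
  | succ s ih => simp only [powDeriv, ih, pow_succ]; noncomm_ring

lemma powDeriv_of_commute {x c : T} (h : Commute x c) (s : ℕ) :
    powDeriv x c s = s • (x ^ (s - 1) * c) := by
  induction s with
  | zero => simp [powDeriv]
  | succ s ih =>
    rw [powDeriv, ih, smul_mul_assoc, mul_assoc, ← h.eq, ← mul_assoc, Nat.add_sub_cancel]
    cases s with
    | zero => simp
    | succ s => rw [Nat.add_sub_cancel, ← pow_succ, ← succ_nsmul]

lemma powDeriv_mul_right {x c y : T} (h : Commute x y) (s : ℕ) :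
    powDeriv x (c * y) s = powDeriv x c s * y := by
  induction s with
  | zero => simp [powDeriv]
  | succ s ih => rw [powDeriv, powDeriv, ih, mul_assoc, ← h.eq]; noncomm_ring

lemma powDeriv_mul_left {x c y : T} (h : Commute x y) (s : ℕ) :
    powDeriv x (y * c) s = y * powDeriv x c s := by
  induction s with
  | zero => simp [powDeriv]
  | succ s ih =>
    rw [powDeriv, powDeriv, ih, ← mul_assoc (x ^ s), (h.pow_left s).eq]; noncomm_ring

/-- Left and right multiplication by `x` commute, so both sides are the same double sum of terms
`x^i c x^j`. -/
lemma powDeriv_comm (x c : T) (m s : ℕ) :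
    powDeriv x (powDeriv x c m) s = powDeriv x (powDeriv x c s) m := by
  induction m with
  | zero =>
    induction s with
    | zero => simp [powDeriv]
    | succ s ih => simp only [powDeriv] at ih ⊢; rw [ih]; simp
  | succ m ih =>
    rw [powDeriv, powDeriv, powDeriv_add, powDeriv_mul_right (Commute.refl x),
      powDeriv_mul_left (Commute.pow_right rfl m), ih]

/-- If `[Λ, ν] = 0` and `[Λ, g] = 1`, then the derivative of `ν^s Λ^k` along `[ν^m Λ^l, g]` in the
variable `ν` is, up to a term symmetric in `(m, l)` and `(s, k)`, equal to
`s l ν^{m+s-1} Λ^{k+l-1}`. -/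
lemma powDeriv_block {ν Λ g : T} (h : Commute ν Λ) (hg : Λ * g - g * Λ = 1) {m s : ℕ}
    (hs : 1 ≤ s) (l k : ℕ) :
    powDeriv ν (ν ^ m * Λ ^ l * g - g * (ν ^ m * Λ ^ l)) s * Λ ^ k =
      powDeriv ν (powDeriv ν (ν * g - g * ν) m) s * Λ ^ (k + l) +
        (s * l) • (ν ^ (m + s - 1) * Λ ^ (k + l - 1)) := by
  have h1 : Λ ^ l * g - g * Λ ^ l = l • Λ ^ (l - 1) := by
    rw [← powDeriv_commutator, hg, powDeriv_of_commute (Commute.one_right _), mul_one]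
  have h2 : ν ^ m * Λ ^ l * g - g * (ν ^ m * Λ ^ l) =
      powDeriv ν (ν * g - g * ν) m * Λ ^ l + ν ^ m * (l • Λ ^ (l - 1)) := by
    rw [powDeriv_commutator, ← h1]; noncomm_ring
  have h3 : Commute ν (ν ^ m * (l • Λ ^ (l - 1))) :=
    (Commute.pow_right rfl m).mul_right ((h.pow_right _).smul_right _)
  rw [h2, powDeriv_add, powDeriv_mul_right (h.pow_right l), powDeriv_of_commute h3, add_mul,
    mul_assoc, ← pow_add, add_comm l k]
  congr 1
  rw [← mul_assoc, ← pow_add, mul_smul_comm, smul_smul, smul_mul_assoc, mul_assoc, ← pow_add]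
  -- The truncated exponents are wrong only for `l = 0`, where the factor `l` vanishes.
  rcases Nat.eq_zero_or_pos l with rfl | hl
  · simp
  · congr 3 <;> omega

/-- Moving `Λ^i` past `μ` costs `i Λ^{i-1}`; the term `μ² Λ^{k+l}` is symmetric and drops out. -/
lemma commutator_mul_pow (μ Λ : T) (h : Λ * μ - μ * Λ = 1) (l k : ℕ) :
    μ * Λ ^ l * (μ * Λ ^ k) - μ * Λ ^ k * (μ * Λ ^ l) =
      ((l : ℤ) - k) • (μ * Λ ^ (k + l - 1)) := by
  have key (j : ℕ) : Λ ^ j * μ = μ * Λ ^ j + j • Λ ^ (j - 1) := by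
    rw [← sub_eq_iff_eq_add', ← powDeriv_commutator, h,
      powDeriv_of_commute (Commute.one_right _), mul_one]
  have aux (i j : ℕ) : μ * Λ ^ i * (μ * Λ ^ j) =
      μ * μ * Λ ^ (i + j) + (i : ℤ) • (μ * Λ ^ (i + j - 1)) := by
    rw [mul_assoc, ← mul_assoc (Λ ^ i), key, add_mul, mul_add, mul_assoc μ, ← pow_add,
      ← mul_assoc, natCast_zsmul, smul_mul_assoc, mul_smul_comm, ← pow_add]
    congr 1
    rcases Nat.eq_zero_or_pos i with rfl | hi
    · simp
    · congr 4; omega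
  rw [aux, aux, add_comm l k, sub_smul]
  abel

/-- Differentiating `q p = 1` gives `d q = -q c`, after which the Leibniz rule applies. -/
lemma map_conj_eq_commutator (d : T →+ T) (hd : ∀ x y, d (x * y) = d x * y + x * d y)
    {p q c x : T} (hpq : p * q = 1) (hqp : q * p = 1) (hp : d p = c * p) (hx : d x = 0) :
    d (p * x * q) = c * (p * x * q) - p * x * q * c := by
  have h1 : d 1 = 0 := by simpa using hd 1 1
  have h2 : d q = -(q * c) := by
    have h := hd q p
    rw [hqp, h1, hp] at h
    calc d q = d q * p * q := by rw [mul_assoc, hpq, mul_one]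
      _ = -(q * c) * (p * q) := by
        rw [eq_neg_of_add_eq_zero_left h.symm]; noncomm_ring
      _ = _ := by rw [hpq, mul_one]
  rw [hd, hd, hp, hx, h2]
  noncomm_ring

end RingIdentities

/-! ### Negative and nonnegative parts -/

section Projections

variable {A : Type*} [CommRing A]

lemma neg_part_add_pos_part (P : Op A) : neg P + pos P = P := by
  ext i
  by_cases h : 0 ≤ i
  · simp [neg, pos, h, not_lt.2 h]
  · simp [neg, pos, h, not_le.1 h]

@[simp] lemma neg_part_add (P Q : Op A) : neg (P + Q) = neg P + neg Q := by
  ext i; by_cases h : i < 0 <;> simp [neg, h]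

@[simp] lemma neg_part_sub (P Q : Op A) : neg (P - Q) = neg P - neg Q := by
  ext i; by_cases h : i < 0 <;> simp [neg, h]

@[simp] lemma neg_part_zsmul (c : ℤ) (P : Op A) : neg (c • P) = c • neg P := by
  ext i; by_cases h : i < 0 <;> simp [neg, h]

@[simp] lemma pos_part_add (P Q : Op A) : pos (P + Q) = pos P + pos Q := by
  ext i; by_cases h : 0 ≤ i <;> simp [pos, h]

@[simp] lemma pos_part_sub (P Q : Op A) : pos (P - Q) = pos P - pos Q := by
  ext i; by_cases h : 0 ≤ i <;> simp [pos, h]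

@[simp] lemma pos_part_zsmul (c : ℤ) (P : Op A) : pos (c • P) = c • pos P := by
  ext i; by_cases h : 0 ≤ i <;> simp [pos, h]

end Projections

/-! ### The Leibniz product on formal operators -/

section Operators

variable {A : Type*} [CommRing A] [Algebra ℚ A]

lemma act_neg_part (δ : Derivation ℚ A A) (P : Op A) : act δ (neg P) = neg (act δ P) := by
  ext i; by_cases h : i < 0 <;> simp [neg, act, h]

lemma act_pos_part (δ : Derivation ℚ A A) (P : Op A) : act δ (pos P) = pos (act δ P) := by
  ext i; by_cases h : 0 ≤ i <;> simp [pos, act, h]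

@[simp] lemma act_add (δ : Derivation ℚ A A) (P Q : Op A) : act δ (P + Q) = act δ P + act δ Q := by
  ext i; simp [act]

@[simp] lemma act_sub (δ : Derivation ℚ A A) (P Q : Op A) : act δ (P - Q) = act δ P - act δ Q := by
  ext i; simp [act]

@[simp] lemma act_neg (δ : Derivation ℚ A A) (P : Op A) : act δ (-P) = -act δ P := by
  ext i; simp [act]

@[simp] lemma act_dpow (δ : Derivation ℚ A A) (i : ℤ) : act δ (dpow A i) = 0 := by
  ext j
  by_cases h : j = i
  · subst h; simp [act, dpow]
  · simp [act, dpow, h]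

lemma iterate_derivation_zero (D : Derivation ℚ A A) (r : ℕ) : (⇑D)^[r] 0 = 0 :=
  Function.iterate_fixed (map_zero D) r

lemma iterate_derivation_add (D : Derivation ℚ A A) (r : ℕ) (f g : A) :
    (⇑D)^[r] (f + g) = (⇑D)^[r] f + (⇑D)^[r] g :=
  iterate_map_add D r f g

lemma leibnizTerm_add_left (D : Derivation ℚ A A) (P P' Q : Op A) (k : ℤ) (p : ℤ × ℕ) :
    leibnizTerm D (P + P') Q k p = leibnizTerm D P Q k p + leibnizTerm D P' Q k p := by
  simp only [leibnizTerm, Pi.add_apply, add_mul, smul_add]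

lemma leibnizTerm_add_right (D : Derivation ℚ A A) (P Q Q' : Op A) (k : ℤ) (p : ℤ × ℕ) :
    leibnizTerm D P (Q + Q') k p = leibnizTerm D P Q k p + leibnizTerm D P Q' k p := by
  simp only [leibnizTerm, Pi.add_apply, iterate_derivation_add, mul_add, smul_add]

lemma map_leibnizTerm {D δ : Derivation ℚ A A} (h : ∀ f, δ (D f) = D (δ f)) (P Q : Op A)
    (k : ℤ) (p : ℤ × ℕ) :
    δ (leibnizTerm D P Q k p) = leibnizTerm D (act δ P) Q k p + leibnizTerm D P (act δ Q) k p := by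
  have hi (r : ℕ) (f : A) : δ ((⇑D)^[r] f) = (⇑D)^[r] (δ f) :=
    Function.Commute.iterate_right (f := δ) (g := D) h r f
  simp only [leibnizTerm, act, map_zsmul, Derivation.leibniz, hi, smul_eq_mul, ← smul_add]
  ring_nf

variable [TopologicalSpace A]

/-- As second derivatives of the coefficients vanish, only `r = 0` and `r = 1` survive in the
Leibniz series. -/
lemma dpow_mul_apply (D : Derivation ℚ A A) (i : ℤ) (Q : Op A) (hQ : ∀ j, D (D (Q j)) = 0)
    (k : ℤ) : mul D (dpow A i) Q k = Q (k - i) + i • D (Q (k - i + 1)) := by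
  have h2 (r : ℕ) (j : ℤ) : (⇑D)^[r + 2] (Q j) = 0 := by
    rw [Function.iterate_add_apply]
    simp [hQ]
  rw [mul, tsum_eq_sum (s := {(i, 0), (i, 1)})]
  · rw [Finset.sum_pair (by simp)]
    simp [leibnizTerm, dpow]
  · rintro ⟨a, r⟩ hr
    by_cases ha : a = i
    · subst ha
      match r with
      | 0 => simp at hr
      | 1 => simp at hr
      | r + 2 => rw [leibnizTerm, h2]; simp
    · simp [leibnizTerm, dpow, ha]

lemma mul_dpow_apply (D : Derivation ℚ A A) (i : ℤ) (Q : Op A) (k : ℤ) :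
    mul D Q (dpow A i) k = Q (k - i) := by
  rw [mul, tsum_eq_single (k - i, 0)]
  · simp [leibnizTerm, dpow]
  · rintro ⟨a, r⟩ hr
    cases r with
    | zero =>
      have : k - a ≠ i := fun h => hr (by simp [← h])
      simp [leibnizTerm, dpow, this]
    | succ r =>
      have : (⇑D)^[r + 1] (dpow A i (k - a + ↑(r + 1))) = 0 := by
        have h := congrFun (act_dpow D i) (k - a + ↑(r + 1))
        simp only [act, Pi.zero_apply] at h
        rw [Function.iterate_succ_apply, h, iterate_derivation_zero]
      rw [leibnizTerm, this]
      simp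

lemma dpow_zero_mul (D : Derivation ℚ A A) (Q : Op A) : mul D (dpow A 0) Q = Q := by
  ext k
  rw [mul, tsum_eq_single (0, 0)]
  · simp [leibnizTerm, dpow]
  · rintro ⟨a, r⟩ hr
    by_cases ha : a = 0
    · subst ha
      have : r ≠ 0 := by simpa using hr
      simp [leibnizTerm, Ring.choose_zero_pos ℤ (Nat.pos_of_ne_zero this)]
    · simp [leibnizTerm, dpow, ha]

lemma mul_dpow_zero (D : Derivation ℚ A A) (Q : Op A) : mul D Q (dpow A 0) = Q := by
  ext k
  simp [mul_dpow_apply]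

lemma dpow_mul_dpow (D : Derivation ℚ A A) (i j : ℤ) :
    mul D (dpow A i) (dpow A j) = dpow A (i + j) := by
  ext k
  rw [mul_dpow_apply]
  simp only [dpow, Pi.single_apply, sub_eq_iff_eq_add]

/-- The commutator of `D^i` with an operator of which a single coefficient depends on `x`, and that
linearly. -/
lemma comm_dpow_of_linear (D : Derivation ℚ A A) (i j : ℤ) (Q : Op A) (c : ℚ)
    (hQ : act D Q = Pi.single j (algebraMap ℚ A c)) (hc : (i : ℚ) * c = 1) :
    comm D (dpow A i) Q = dpow A (i + j - 1) := by
  have h1 (r : ℤ) : D (Q r) = (Pi.single j (algebraMap ℚ A c) : Op A) r := congrFun hQ r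
  have h2 (r : ℤ) : D (D (Q r)) = 0 := by
    rw [h1]
    by_cases h : r = j
    · subst h; simp
    · simp [h]
  ext k
  rw [comm, Pi.sub_apply, dpow_mul_apply D i Q h2, mul_dpow_apply, h1, dpow]
  by_cases h : k = i + j - 1
  · subst h
    rw [show i + j - 1 - i + 1 = j by ring]
    rw [Pi.single_eq_same, Pi.single_eq_same, zsmul_eq_mul, ← map_intCast (algebraMap ℚ A),
      ← map_mul, hc, map_one, add_sub_cancel_left]
  · have : k - i + 1 ≠ j := fun h' => h (by omega)
    simp [h, this]

lemma mul_neg_neg_apply (D : Derivation ℚ A A) (P Q : Op A) {k : ℤ} (hk : 0 ≤ k) :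
    mul D (neg P) (neg Q) k = 0 := by
  rw [mul, tsum_congr, tsum_zero]
  rintro ⟨i, r⟩
  by_cases hi : i < 0
  · have : ¬ k - i + r < 0 := by omega
    simp [leibnizTerm, neg, this]
  · simp [leibnizTerm, neg, hi]

/-- With `i, j ≥ 0`, a negative index `i + j - r` forces `r > i`, and then `binom(i, r) = 0`. -/
lemma mul_pos_pos_apply (D : Derivation ℚ A A) (P Q : Op A) {k : ℤ} (hk : k < 0) :
    mul D (pos P) (pos Q) k = 0 := by
  rw [mul, tsum_congr, tsum_zero]
  rintro ⟨i, r⟩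
  by_cases hi : 0 ≤ i
  · lift i to ℕ using hi
    rcases lt_or_ge i r with h | h
    · simp [leibnizTerm, Ring.choose_natCast, Nat.choose_eq_zero_of_lt h]
    · have : ¬ (0 : ℤ) ≤ k - i + r := by omega
      simp [leibnizTerm, pos, this]
  · simp [leibnizTerm, pos, hi]

lemma neg_comm_neg_neg (D : Derivation ℚ A A) (P Q : Op A) :
    neg (comm D (neg P) (neg Q)) = comm D (neg P) (neg Q) := by
  ext i
  by_cases h : i < 0
  · simp [neg, h]
  · have := not_lt.1 h
    rw [comm, Pi.sub_apply, mul_neg_neg_apply D P Q this, mul_neg_neg_apply D Q P this]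
    simp [neg, h]

lemma pos_comm_neg_neg (D : Derivation ℚ A A) (P Q : Op A) :
    pos (comm D (neg P) (neg Q)) = 0 := by
  have h := neg_part_add_pos_part (comm D (neg P) (neg Q))
  rw [neg_comm_neg_neg] at h
  simpa using h

lemma pos_comm_pos_pos (D : Derivation ℚ A A) (P Q : Op A) :
    pos (comm D (pos P) (pos Q)) = comm D (pos P) (pos Q) := by
  ext i
  by_cases h : 0 ≤ i
  · simp [pos, h]
  · have := not_le.1 h
    rw [comm, Pi.sub_apply, mul_pos_pos_apply D P Q this, mul_pos_pos_apply D Q P this]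
    simp [pos, h]

lemma neg_comm_pos_pos (D : Derivation ℚ A A) (P Q : Op A) :
    neg (comm D (pos P) (pos Q)) = 0 := by
  have h := neg_part_add_pos_part (comm D (pos P) (pos Q))
  rw [pos_comm_pos_pos] at h
  simpa using h

namespace OperatorRing

variable {D : Derivation ℚ A A} (R : OperatorRing D)

instance : Mul R.carrier := ⟨fun x y => ⟨mul D x y, R.mul_mem _ x.2 _ y.2⟩⟩

instance : One R.carrier := ⟨⟨dpow A 0, R.dpow_mem 0⟩⟩

variable {R}

lemma coe_mul (x y : R.carrier) : ((x * y : R.carrier) : Op A) = mul D x y := rfl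

lemma coe_one : ((1 : R.carrier) : Op A) = dpow A 0 := rfl

end OperatorRing

variable [IsTopologicalRing A] [T2Space A]

lemma mul_add_of_summable {D : Derivation ℚ A A} {P Q Q' : Op A}
    (h : ∀ k, Summable (leibnizTerm D P Q k)) (h' : ∀ k, Summable (leibnizTerm D P Q' k)) :
    mul D P (Q + Q') = mul D P Q + mul D P Q' := by
  ext k
  simp only [mul, leibnizTerm_add_right, Pi.add_apply]
  exact (h k).tsum_add (h' k)

lemma add_mul_of_summable {D : Derivation ℚ A A} {P P' Q : Op A}
    (h : ∀ k, Summable (leibnizTerm D P Q k)) (h' : ∀ k, Summable (leibnizTerm D P' Q k)) :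
    mul D (P + P') Q = mul D P Q + mul D P' Q := by
  ext k
  simp only [mul, leibnizTerm_add_left, Pi.add_apply]
  exact (h k).tsum_add (h' k)

lemma sub_mul_of_summable {D : Derivation ℚ A A} {P P' Q : Op A}
    (h : ∀ k, Summable (leibnizTerm D P Q k)) (h' : ∀ k, Summable (leibnizTerm D P' Q k)) :
    mul D (P - P') Q = mul D P Q - mul D P' Q := by
  have hn (k : ℤ) : leibnizTerm D (P - P') Q k = leibnizTerm D P Q k - leibnizTerm D P' Q k := by
    ext p
    simp only [leibnizTerm, Pi.sub_apply, sub_mul, smul_sub]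
  ext k
  simp only [mul, hn]
  exact (h k).tsum_sub (h' k)

/-- Continuity carries `δ` through the infinite sum; each term splits by the Leibniz rule because
`δ` commutes with `D`. -/
lemma act_mul_of_summable {D δ : Derivation ℚ A A} (hc : Continuous δ)
    (hD : ∀ f, δ (D f) = D (δ f)) {P Q : Op A} (h : ∀ k, Summable (leibnizTerm D P Q k))
    (hl : ∀ k, Summable (leibnizTerm D (act δ P) Q k))
    (hr : ∀ k, Summable (leibnizTerm D P (act δ Q) k)) :
    act δ (mul D P Q) = mul D (act δ P) Q + mul D P (act δ Q) := by
  ext k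
  rw [Pi.add_apply, act, mul, (h k).map_tsum δ hc]
  simp only [map_leibnizTerm hD]
  exact (hl k).tsum_add (hr k)

/-! ### Rings of operators as associative rings; conjugation by dressing operators -/

namespace OperatorRing

variable {D : Derivation ℚ A A} (R : OperatorRing D)

/-- The product is the same function `mul` in every ring of operators, so identities obtained in
different rings can be compared in `Op A`. -/
instance : Ring R.carrier where
  mul_assoc x y z := Subtype.ext (R.mul_assoc _ x.2 _ y.2 _ z.2)
  one_mul x := Subtype.ext (dpow_zero_mul D x)
  mul_one x := Subtype.ext (mul_dpow_zero D x)
  left_distrib x y z := Subtype.ext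
    (mul_add_of_summable (R.summable _ x.2 _ y.2) (R.summable _ x.2 _ z.2))
  right_distrib x y z := Subtype.ext
    (add_mul_of_summable (R.summable _ x.2 _ z.2) (R.summable _ y.2 _ z.2))
  zero_mul x := by
    apply Subtype.ext
    ext k
    simp [coe_mul, mul, leibnizTerm]
  mul_zero x := by
    apply Subtype.ext
    ext k
    simp [coe_mul, mul, leibnizTerm]
  zsmul := fun n x => n • x
  zsmul_zero' := zero_zsmul
  zsmul_succ' n x := SubNegMonoid.zsmul_succ' n x
  zsmul_neg' n x := SubNegMonoid.zsmul_neg' n x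
  neg_add_cancel := neg_add_cancel
  sub_eq_add_neg := sub_eq_add_neg

variable {R}

lemma coe_pow (x : R.carrier) (j : ℕ) : ((x ^ j : R.carrier) : Op A) = pow D x j := by
  induction j with
  | zero => rw [pow_zero]; rfl
  | succ j ih => rw [pow_succ, coe_mul, ih]; rfl

lemma pow_mem {P : Op A} (hP : P ∈ R.carrier) (j : ℕ) : pow D P j ∈ R.carrier :=
  coe_pow (⟨P, hP⟩ : R.carrier) j ▸ ((⟨P, hP⟩ : R.carrier) ^ j).2

/-- The derivatives are supplied as elements `x'`, `y'`, so `δ` need not preserve `R`. This matters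
for the common ring of mixed products, which no flow is assumed to preserve. -/
lemma act_mul {δ : Derivation ℚ A A} (hc : Continuous δ) (hD : ∀ f, δ (D f) = D (δ f))
    {x y x' y' : R.carrier} (hx : act δ x = x') (hy : act δ y = y') :
    act δ (x * y : R.carrier) = (x' * y + x * y' : R.carrier) := by
  have := act_mul_of_summable hc hD (R.summable _ x.2 _ y.2)
    (by rw [hx]; exact R.summable _ x'.2 _ y.2) (by rw [hy]; exact R.summable _ x.2 _ y'.2)
  rw [coe_mul, this, hx, hy]
  rfl

lemma act_pow {δ : Derivation ℚ A A} (hc : Continuous δ) (hD : ∀ f, δ (D f) = D (δ f))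
    {x x' : R.carrier} (hx : act δ x = x') (s : ℕ) :
    act δ (x ^ s : R.carrier) = (powDeriv x x' s : R.carrier) := by
  induction s with
  | zero => rw [pow_zero, coe_one, act_dpow]; rfl
  | succ s ih => rw [pow_succ, act_mul hc hD ih hx]; rfl

/-- A derivation that acts on `P` by left multiplication with `C` acts on conjugates by `P` of
constant operators by the commutator with `C`. -/
lemma act_conj {δ : Derivation ℚ A A} (hc : Continuous δ) (hD : ∀ f, δ (D f) = D (δ f))
    (hR : ∀ P ∈ R.carrier, act δ P ∈ R.carrier) {P Pinv C X : Op A}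
    (hP : P ∈ R.carrier) (hPinv : Pinv ∈ R.carrier) (hC : C ∈ R.carrier) (hX : X ∈ R.carrier)
    (h1 : mul D P Pinv = dpow A 0) (h2 : mul D Pinv P = dpow A 0)
    (hδP : act δ P = mul D C P) (hδX : act δ X = 0) :
    act δ (mul D (mul D P X) Pinv) = comm D C (mul D (mul D P X) Pinv) := by
  let d : R.carrier →+ R.carrier := AddMonoidHom.mk' (fun x => ⟨act δ x, hR _ x.2⟩)
    fun x y => Subtype.ext (act_add δ x y)
  have hd (x y : R.carrier) : d (x * y) = d x * y + x * d y :=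
    Subtype.ext (act_mul hc hD (x' := d x) (y' := d y) rfl rfl)
  exact congrArg Subtype.val (map_conj_eq_commutator d hd (p := ⟨P, hP⟩) (q := ⟨Pinv, hPinv⟩)
    (c := ⟨C, hC⟩) (x := ⟨X, hX⟩) (Subtype.ext h1) (Subtype.ext h2) (Subtype.ext hδP)
    (Subtype.ext hδX))

lemma comm_conj {P Pinv X Y : Op A}
    (hP : P ∈ R.carrier) (hPinv : Pinv ∈ R.carrier) (hX : X ∈ R.carrier) (hY : Y ∈ R.carrier)
    (h1 : mul D P Pinv = dpow A 0) (h2 : mul D Pinv P = dpow A 0)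
    (hXY : comm D X Y = dpow A 0) :
    comm D (mul D (mul D P X) Pinv) (mul D (mul D P Y) Pinv) = dpow A 0 := by
  lift P to R.carrier using hP
  lift Pinv to R.carrier using hPinv
  lift X to R.carrier using hX
  lift Y to R.carrier using hY
  have h1 : P * Pinv = 1 := Subtype.ext h1
  have h2 : Pinv * P = 1 := Subtype.ext h2
  have hXY : X * Y - Y * X = 1 := Subtype.ext hXY
  have key : P * X * Pinv * (P * Y * Pinv) - P * Y * Pinv * (P * X * Pinv) = 1 := by
    calc _ = P * X * (Pinv * P) * Y * Pinv - P * Y * (Pinv * P) * X * Pinv := by noncomm_ring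
      _ = P * (X * Y - Y * X) * Pinv := by rw [h2]; noncomm_ring
      _ = 1 := by rw [hXY, mul_one, h1]
  exact congrArg Subtype.val key

lemma pow_conj_dpow {P Pinv : Op A} (hP : P ∈ R.carrier) (hPinv : Pinv ∈ R.carrier)
    (h1 : mul D P Pinv = dpow A 0) (h2 : mul D Pinv P = dpow A 0) (i : ℤ) (j : ℕ) :
    pow D (mul D (mul D P (dpow A i)) Pinv) j = mul D (mul D P (dpow A (j * i))) Pinv := by
  have hd := R.dpow_mem
  lift P to R.carrier using hP
  lift Pinv to R.carrier using hPinv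
  have h1 : P * Pinv = 1 := Subtype.ext h1
  have h2 : Pinv * P = 1 := Subtype.ext h2
  let e (i : ℤ) : R.carrier := ⟨dpow A i, hd i⟩
  have he (i j : ℤ) : e i * e j = e (i + j) := Subtype.ext (dpow_mul_dpow D i j)
  have key : (P * e i * Pinv) ^ j = P * e (j * i) * Pinv := by
    induction j with
    | zero => simp [show e 0 = 1 from rfl, h1]
    | succ j ih =>
      rw [pow_succ, ih]
      calc _ = P * e (j * i) * (Pinv * P) * e i * Pinv := by noncomm_ring
        _ = P * (e (j * i) * e i) * Pinv := by rw [h2]; noncomm_ring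
        _ = _ := by rw [he]; congr 4; push_cast; ring
  rw [← coe_mul (R := R) P (e i), ← coe_mul, ← coe_pow, key]
  rfl

end OperatorRing

end Operators

/-! ### Canonical pairs and the Orlov–Schulman operators -/

section Hierarchy

variable {A : Type*} [CommRing A] [Algebra ℚ A]

lemma odd_toNat {i : ℤ} (h : Odd i) (hi : 0 < i) : Odd i.toNat := by
  lift i to ℕ using hi.le
  exact_mod_cast h

lemma odd_add_two_mul {i : ℤ} (h : Odd i) (n : ℕ) : Odd (i + 2 * n) :=
  h.add_even (even_two_mul _)

lemma odd_two_sub {i : ℤ} (h : Odd i) : Odd (2 - i) :=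
  even_two.sub_odd h

lemma act_gammaL_eq_zero {t : ℕ → A} {δ : Derivation ℚ A A} (h : ∀ k, Odd k → δ (t k) = 0)
    (n : ℕ) : act δ (gammaL n t) = 0 := by
  ext i
  simp only [act, gammaL]
  split_ifs with hi
  · rw [δ.map_smul, h _ (odd_toNat (odd_add_two_mul hi.1 n) hi.2)]; simp
  · simp

lemma act_gammaR_eq_zero {x : A} {th : ℕ → A} {δ : Derivation ℚ A A} (hx : δ x = 0)
    (h : ∀ k, Odd k → δ (th k) = 0) : act δ (gammaR x th) = 0 := by
  ext i
  simp only [act, gammaR]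
  split_ifs with h3 hi
  · simp [hx]
  · rw [map_neg, δ.map_smul, h _ (odd_toNat (odd_two_sub hi.1) hi.2)]; simp
  · simp

variable [TopologicalSpace A]

lemma Setting.D_t (S : Setting A) {j : ℕ} (hj : Odd j) : S.D (S.t j) = if j = 1 then 1 else 0 := by
  rw [← S.dt_one, S.dt_t 1 j odd_one hj]
  simp [eq_comm]

lemma Setting.D_th (S : Setting A) {j : ℕ} (hj : Odd j) : S.D (S.th j) = 0 := by
  rw [← S.dt_one, S.dt_th 1 j odd_one hj]

/-- Among the times only `t_1 = x` depends on `x`; it sits at `D^{1-2n}` with coefficient `1/(2n)`.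
-/
lemma comm_dpow_gammaL (S : Setting A) {n : ℕ} (hn : n ≠ 0) :
    comm S.D (dpow A (2 * n)) (gammaL n S.t) = dpow A 0 := by
  have hn' : (n : ℚ) ≠ 0 := by exact_mod_cast hn
  have := comm_dpow_of_linear S.D (2 * n) (1 - 2 * n) (gammaL n S.t) (1 / (2 * n)) ?_ ?_
  · rw [this]; congr 1; ring
  · ext i
    simp only [act, gammaL]
    by_cases hi : i = 1 - 2 * n
    · subst hi
      have h : Odd ((1 : ℤ) - 2 * n) := odd_one.sub_even (even_two_mul _)
      have h1 := S.D_t odd_one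
      simp only [if_true] at h1
      simp [h, S.D.map_smul, h1, Algebra.algebraMap_eq_smul_one]
    · rw [Pi.single_eq_of_ne hi]
      split_ifs with h
      · have h1 := odd_toNat (odd_add_two_mul h.1 n) h.2
        rw [S.D.map_smul, S.D_t h1, if_neg (by omega), smul_zero]
      · simp
  · push_cast; field_simp

/-- Only the term `-(x/2) D^3` depends on `x`, and `(-2)(-1/2) = 1`. -/
lemma comm_dpow_gammaR (S : Setting A) :
    comm S.D (dpow A (-2)) (gammaR (S.t 1) S.th) = dpow A 0 := by
  have := comm_dpow_of_linear S.D (-2) 3 (gammaR (S.t 1) S.th) (-(1 / 2)) ?_ ?_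
  · rw [this]; rfl
  · ext i
    simp only [act, gammaR]
    by_cases hi : i = 3
    · subst hi
      have h1 := S.D_t odd_one
      simp only [if_true] at h1
      simp [S.D.map_smul, h1, Algebra.algebraMap_eq_smul_one]
    · rw [Pi.single_eq_of_ne hi, if_neg hi]
      split_ifs with h
      · rw [map_neg, S.D.map_smul, S.D_th (odd_toNat (odd_two_sub h.1) h.2), smul_zero, neg_zero]
      · simp
  · norm_num

namespace Dressing

variable {S : Setting A} {W : Dressing S} {n : ℕ}

lemma M_mem_minus (hW : W.SolvesDS n) : W.M n ∈ S.minus.carrier :=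
  S.minus.mul_mem _ (S.minus.mul_mem _ W.Φ_mem _ hW.gammaL_mem) _ W.Φinv_mem

lemma Mh_mem_plus (hW : W.SolvesDS n) : W.Mh ∈ S.plus.carrier :=
  S.plus.mul_mem _ (S.plus.mul_mem _ W.Φh_mem _ hW.gammaR_mem) _ W.Φhinv_mem

/-- The negative and the nonnegative parts of `P` can be composed with `Φ` and `Φ̂`. -/
def Splits (S : Setting A) (P : Op A) : Prop :=
  neg P ∈ S.minus.carrier ∧ pos P ∈ S.plus.carrier

lemma splits_sub {P Q : Op A} (hP : P ∈ S.minus.carrier) (hQ : Q ∈ S.plus.carrier) :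
    Splits S (P - Q) := by
  constructor
  · rw [neg_part_sub]
    exact sub_mem (S.minus.neg_mem _ hP) (S.neg_plus _ hQ)
  · rw [pos_part_sub]
    exact sub_mem (S.pos_minus _ hP) (S.plus.pos_mem _ hQ)

variable [IsTopologicalRing A] [T2Space A]

lemma Lax_eq_conj (W : Dressing S) (n : ℕ) :
    W.Lax n = mul S.D (mul S.D W.Φ (dpow A (2 * n))) W.Φinv := by
  rw [Lax, L, OperatorRing.pow_conj_dpow W.Φ_mem W.Φinv_mem W.Φ_mul_inv W.Φ_inv_mul]
  simp

lemma Lax_mem_minus (W : Dressing S) (n : ℕ) : W.Lax n ∈ S.minus.carrier := by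
  rw [Lax_eq_conj]
  exact S.minus.mul_mem _ (S.minus.mul_mem _ W.Φ_mem _ (S.minus.dpow_mem _)) _ W.Φinv_mem

/-- The reduction `L^{2n} = L̂^2` enters here: it makes 𝓛 a conjugate by `Φ̂` as well, and so puts
it in both rings. -/
lemma Lax_eq_conj_hat (hW : W.SolvesDS n) :
    W.Lax n = mul S.D (mul S.D W.Φh (dpow A (-2))) W.Φhinv := by
  rw [Lax, hW.constraint, Lh,
    OperatorRing.pow_conj_dpow W.Φh_mem W.Φhinv_mem W.Φh_mul_inv W.Φh_inv_mul]
  norm_num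

lemma Lax_mem_plus (hW : W.SolvesDS n) : W.Lax n ∈ S.plus.carrier := by
  rw [Lax_eq_conj_hat hW]
  exact S.plus.mul_mem _ (S.plus.mul_mem _ W.Φh_mem _ (S.plus.dpow_mem _)) _ W.Φhinv_mem

lemma comm_Lax_M (hn : n ≠ 0) (hW : W.SolvesDS n) : comm S.D (W.Lax n) (W.M n) = dpow A 0 := by
  rw [Lax_eq_conj]
  exact OperatorRing.comm_conj W.Φ_mem W.Φinv_mem (S.minus.dpow_mem _) hW.gammaL_mem
    W.Φ_mul_inv W.Φ_inv_mul (comm_dpow_gammaL S hn)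

lemma comm_Lax_Mh (hW : W.SolvesDS n) : comm S.D (W.Lax n) W.Mh = dpow A 0 := by
  rw [Lax_eq_conj_hat hW]
  exact OperatorRing.comm_conj W.Φh_mem W.Φhinv_mem (S.plus.dpow_mem _) hW.gammaR_mem
    W.Φh_mul_inv W.Φh_inv_mul (comm_dpow_gammaR S)

/-! ### Action of an additional flow on 𝓛, 𝓜 and 𝓜̂ -/

section Flow

variable {m l : ℕ} {δ : Derivation ℚ A A}

lemma neg_mul_of_mem {P Q : Op A} {D : Derivation ℚ A A} {R : OperatorRing D}
    (hP : P ∈ R.carrier) (hQ : Q ∈ R.carrier) : mul D (-P) Q = -mul D P Q :=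
  congrArg Subtype.val (neg_mul (⟨P, hP⟩ : R.carrier) ⟨Q, hQ⟩)

lemma act_Φ_eq_mul (hδ : W.IsBlockFlow n m l δ) (hB : Splits S (W.B n m l)) :
    act δ W.Φ = mul S.D (-neg (W.B n m l)) W.Φ := by
  rw [hδ.act_Φ, neg_mul_of_mem hB.1 W.Φ_mem]

lemma act_Lax (hδ : W.IsBlockFlow n m l δ) (hB : Splits S (W.B n m l)) :
    act δ (W.Lax n) = comm S.D (-neg (W.B n m l)) (W.Lax n) := by
  rw [Lax_eq_conj]
  exact OperatorRing.act_conj hδ.continuous hδ.comm_D hδ.act_minus W.Φ_mem W.Φinv_mem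
    (S.minus.carrier.neg_mem hB.1) (S.minus.dpow_mem _) W.Φ_mul_inv W.Φ_inv_mul
    (act_Φ_eq_mul hδ hB) (act_dpow _ _)

lemma act_M (hW : W.SolvesDS n) (hδ : W.IsBlockFlow n m l δ) (hB : Splits S (W.B n m l)) :
    act δ (W.M n) = comm S.D (-neg (W.B n m l)) (W.M n) :=
  OperatorRing.act_conj hδ.continuous hδ.comm_D hδ.act_minus W.Φ_mem W.Φinv_mem
    (S.minus.carrier.neg_mem hB.1) hW.gammaL_mem W.Φ_mul_inv W.Φ_inv_mul
    (act_Φ_eq_mul hδ hB) (act_gammaL_eq_zero hδ.apply_t n)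

lemma act_Lax_hat (hW : W.SolvesDS n) (hδ : W.IsBlockFlow n m l δ) (hB : Splits S (W.B n m l)) :
    act δ (W.Lax n) = comm S.D (pos (W.B n m l)) (W.Lax n) := by
  rw [Lax_eq_conj_hat hW]
  exact OperatorRing.act_conj hδ.continuous hδ.comm_D hδ.act_plus W.Φh_mem W.Φhinv_mem
    hB.2 (S.plus.dpow_mem _) W.Φh_mul_inv W.Φh_inv_mul hδ.act_Φh (act_dpow _ _)

lemma act_Mh (hW : W.SolvesDS n) (hδ : W.IsBlockFlow n m l δ) (hB : Splits S (W.B n m l)) :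
    act δ W.Mh = comm S.D (pos (W.B n m l)) W.Mh :=
  OperatorRing.act_conj hδ.continuous hδ.comm_D hδ.act_plus W.Φh_mem W.Φhinv_mem
    hB.2 hW.gammaR_mem W.Φh_mul_inv W.Φh_inv_mul hδ.act_Φh
    (act_gammaR_eq_zero (hδ.apply_t 1 odd_one) hδ.apply_th)

end Flow

/-- Distributivity here needs only convergence of each product, one in `minus` and one in `plus`; no
common ring is involved. -/
lemma B_one (hW : W.SolvesDS n) (l : ℕ) : W.B n 1 l =
    mul S.D (W.M n) (pow S.D (W.Lax n) l) - mul S.D W.Mh (pow S.D (W.Lax n) l) := by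
  have h : pow S.D (W.M n - W.Mh) 1 = W.M n - W.Mh := dpow_zero_mul _ _
  rw [B, h, sub_mul_of_summable]
  · exact S.minus.summable _ (M_mem_minus hW) _ (OperatorRing.pow_mem (Lax_mem_minus W n) l)
  · exact S.plus.summable _ (Mh_mem_plus hW) _ (OperatorRing.pow_mem (Lax_mem_plus hW) l)

/-- The zero-curvature equation of two additional flows: for `B₁`, `B₂`, `B₃` the generators of
`δ₁`, `δ₂` and of a multiple `c` of a third flow, it expresses `[δ₁, δ₂] = c δ₃` on the dressing
operators. -/
def ZeroCurvature (D δ₁ δ₂ : Derivation ℚ A A) (B₁ B₂ B₃ : Op A) (c : ℤ) : Prop :=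
  act δ₁ B₂ - act δ₂ B₁ =
    comm D (neg B₂) (neg B₁) - comm D (pos B₂) (pos B₁) + c • B₃

/-! ### Zero curvature and the Block relation -/

section Commutator

variable {m l s k m' l' : ℕ} {δ₁ δ₂ : Derivation ℚ A A} {c : ℤ}

/-- The negative part of the zero-curvature equation loses `[B₂₊, B₁₊]` and keeps `[B₂₋, B₁₋]`,
which is exactly the quadratic term produced by letting the flows act twice on `Φ`. -/
lemma commutator_Φ (h₁ : W.IsBlockFlow n m l δ₁) (h₂ : W.IsBlockFlow n s k δ₂)
    (hB₁ : Splits S (W.B n m l)) (hB₂ : Splits S (W.B n s k)) (hB₃ : Splits S (W.B n m' l'))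
    (h : ZeroCurvature S.D δ₁ δ₂ (W.B n m l) (W.B n s k) (W.B n m' l') c) :
    act δ₁ (act δ₂ W.Φ) - act δ₂ (act δ₁ W.Φ) =
      c • -mul S.D (neg (W.B n m' l')) W.Φ := by
  have hneg := congrArg neg h
  simp only [neg_part_sub, neg_part_add, neg_part_zsmul, neg_comm_neg_neg, neg_comm_pos_pos,
    ← act_neg_part, sub_zero] at hneg
  let φ : S.minus.carrier := ⟨W.Φ, W.Φ_mem⟩
  let x₁ : S.minus.carrier := ⟨_, hB₁.1⟩
  let x₂ : S.minus.carrier := ⟨_, hB₂.1⟩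
  let z : S.minus.carrier := ⟨_, hB₃.1⟩
  let y₁ : S.minus.carrier := ⟨_, h₁.act_minus _ hB₂.1⟩
  let y₂ : S.minus.carrier := ⟨_, h₂.act_minus _ hB₁.1⟩
  have hy : y₁ - y₂ = x₂ * x₁ - x₁ * x₂ + c • z := Subtype.ext hneg
  have e₁ : act δ₁ (x₂ * φ : S.minus.carrier) = (y₁ * φ + x₂ * -(x₁ * φ) : S.minus.carrier) :=
    OperatorRing.act_mul h₁.continuous h₁.comm_D rfl h₁.act_Φ
  have e₂ : act δ₂ (x₁ * φ : S.minus.carrier) = (y₂ * φ + x₁ * -(x₂ * φ) : S.minus.carrier) :=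
    OperatorRing.act_mul h₂.continuous h₂.comm_D rfl h₂.act_Φ
  rw [OperatorRing.coe_mul] at e₁ e₂
  rw [h₁.act_Φ, h₂.act_Φ, act_neg, act_neg, e₁, e₂]
  have key : -(y₁ * φ + x₂ * -(x₁ * φ)) - -(y₂ * φ + x₁ * -(x₂ * φ)) = c • -(z * φ) := by
    calc _ = -((y₁ - y₂) - (x₂ * x₁ - x₁ * x₂)) * φ := by noncomm_ring
      _ = _ := by rw [hy, add_sub_cancel_left, neg_mul, smul_mul_assoc, smul_neg]
  exact congrArg Subtype.val key

lemma commutator_Φh (h₁ : W.IsBlockFlow n m l δ₁) (h₂ : W.IsBlockFlow n s k δ₂)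
    (hB₁ : Splits S (W.B n m l)) (hB₂ : Splits S (W.B n s k)) (hB₃ : Splits S (W.B n m' l'))
    (h : ZeroCurvature S.D δ₁ δ₂ (W.B n m l) (W.B n s k) (W.B n m' l') c) :
    act δ₁ (act δ₂ W.Φh) - act δ₂ (act δ₁ W.Φh) =
      c • mul S.D (pos (W.B n m' l')) W.Φh := by
  have hpos := congrArg pos h
  simp only [pos_part_sub, pos_part_add, pos_part_zsmul, pos_comm_neg_neg, pos_comm_pos_pos,
    ← act_pos_part, zero_sub] at hpos
  let φ : S.plus.carrier := ⟨W.Φh, W.Φh_mem⟩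
  let x₁ : S.plus.carrier := ⟨_, hB₁.2⟩
  let x₂ : S.plus.carrier := ⟨_, hB₂.2⟩
  let z : S.plus.carrier := ⟨_, hB₃.2⟩
  let y₁ : S.plus.carrier := ⟨_, h₁.act_plus _ hB₂.2⟩
  let y₂ : S.plus.carrier := ⟨_, h₂.act_plus _ hB₁.2⟩
  have hy : y₁ - y₂ = -(x₂ * x₁ - x₁ * x₂) + c • z := Subtype.ext hpos
  have e₁ : act δ₁ (x₂ * φ : S.plus.carrier) = (y₁ * φ + x₂ * (x₁ * φ) : S.plus.carrier) :=
    OperatorRing.act_mul h₁.continuous h₁.comm_D rfl h₁.act_Φh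
  have e₂ : act δ₂ (x₁ * φ : S.plus.carrier) = (y₂ * φ + x₁ * (x₂ * φ) : S.plus.carrier) :=
    OperatorRing.act_mul h₂.continuous h₂.comm_D rfl h₂.act_Φh
  rw [OperatorRing.coe_mul] at e₁ e₂
  rw [h₁.act_Φh, h₂.act_Φh, e₁, e₂]
  have key : y₁ * φ + x₂ * (x₁ * φ) - (y₂ * φ + x₁ * (x₂ * φ)) = c • (z * φ) := by
    calc _ = ((y₁ - y₂) - -(x₂ * x₁ - x₁ * x₂)) * φ := by noncomm_ring
      _ = _ := by rw [hy, add_sub_cancel_left, smul_mul_assoc]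
  exact congrArg Subtype.val key

/-- Without mixed products: the zero-curvature equation for two generators linear in `𝓜 - 𝓜̂`. -/
lemma zeroCurvature_linear (hn : n ≠ 0) (hW : W.SolvesDS n)
    (h₁ : W.IsBlockFlow n 1 l δ₁) (h₂ : W.IsBlockFlow n 1 k δ₂)
    (hB₁ : Splits S (W.B n 1 l)) (hB₂ : Splits S (W.B n 1 k)) :
    ZeroCurvature S.D δ₁ δ₂ (W.B n 1 l) (W.B n 1 k) (W.B n 1 (k + l - 1)) ((k : ℤ) - l) := by
  let a (j : ℕ) : S.minus.carrier := ⟨W.M n, M_mem_minus hW⟩ * ⟨W.Lax n, Lax_mem_minus W n⟩ ^ j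
  let b (j : ℕ) : S.plus.carrier := ⟨W.Mh, Mh_mem_plus hW⟩ * ⟨W.Lax n, Lax_mem_plus hW⟩ ^ j
  have hab (j : ℕ) : W.B n 1 j = (a j : Op A) - b j := by
    rw [B_one hW, OperatorRing.coe_mul, OperatorRing.coe_mul, OperatorRing.coe_pow,
      OperatorRing.coe_pow]
  have ha : a l * a k - a k * a l = ((l : ℤ) - k) • a (k + l - 1) :=
    commutator_mul_pow _ _ (Subtype.ext (comm_Lax_M hn hW)) l k
  have hb : b l * b k - b k * b l = ((l : ℤ) - k) • b (k + l - 1) :=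
    commutator_mul_pow _ _ (Subtype.ext (comm_Lax_Mh hW)) l k
  have act_a {δ : Derivation ℚ A A} {i : ℕ} (hδ : W.IsBlockFlow n 1 i δ)
      (hB : Splits S (W.B n 1 i)) (j : ℕ) :
      act δ (a j) = (-(⟨_, hB.1⟩ * a j - a j * ⟨_, hB.1⟩) : S.minus.carrier) := by
    have e₁ := act_M hW hδ hB
    have e₂ := act_Lax hδ hB
    let u : S.minus.carrier := ⟨_, hB.1⟩
    let μ : S.minus.carrier := ⟨W.M n, M_mem_minus hW⟩
    let Λ : S.minus.carrier := ⟨W.Lax n, Lax_mem_minus W n⟩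
    have := OperatorRing.act_mul (x := μ) (y := Λ ^ j) hδ.continuous hδ.comm_D
      (x' := (-u) * μ - μ * (-u)) (y' := powDeriv Λ (Λ * u - u * Λ) j) e₁
      (OperatorRing.act_pow hδ.continuous hδ.comm_D (by
        rw [e₂]
        have : (-u) * Λ - Λ * (-u) = Λ * u - u * Λ := by noncomm_ring
        exact congrArg Subtype.val this) j)
    rw [this, powDeriv_commutator]
    congr 1
    change _ = -(u * (μ * Λ ^ j) - μ * Λ ^ j * u)
    noncomm_ring
  have act_b {δ : Derivation ℚ A A} {i : ℕ} (hδ : W.IsBlockFlow n 1 i δ)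
      (hB : Splits S (W.B n 1 i)) (j : ℕ) :
      act δ (b j) = (⟨_, hB.2⟩ * b j - b j * ⟨_, hB.2⟩ : S.plus.carrier) := by
    have e₁ := act_Mh hW hδ hB
    have e₂ := act_Lax_hat hW hδ hB
    let v : S.plus.carrier := ⟨_, hB.2⟩
    let μ : S.plus.carrier := ⟨W.Mh, Mh_mem_plus hW⟩
    let Λ : S.plus.carrier := ⟨W.Lax n, Lax_mem_plus hW⟩
    have := OperatorRing.act_mul (x := μ) (y := Λ ^ j) hδ.continuous hδ.comm_D
      (x' := v * μ - μ * v) (y' := powDeriv Λ (Λ * (-v) - (-v) * Λ) j) e₁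
      (OperatorRing.act_pow hδ.continuous hδ.comm_D (by
        rw [e₂]
        have : v * Λ - Λ * v = Λ * (-v) - (-v) * Λ := by noncomm_ring
        exact congrArg Subtype.val this) j)
    rw [this, powDeriv_commutator]
    congr 1
    change _ = v * (μ * Λ ^ j) - μ * Λ ^ j * v
    noncomm_ring
  -- The parts `(𝓜Λ^j)₊` and `(𝓜̂Λ^j)₋` lie in both rings, so each gets two names.
  let ap (j : ℕ) : S.minus.carrier := ⟨pos (a j), S.minus.pos_mem _ (a j).2⟩
  let an (j : ℕ) : S.minus.carrier := ⟨neg (a j), S.minus.neg_mem _ (a j).2⟩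
  let bn (j : ℕ) : S.minus.carrier := ⟨neg (b j), S.neg_plus _ (b j).2⟩
  let ap' (j : ℕ) : S.plus.carrier := ⟨pos (a j), S.pos_minus _ (a j).2⟩
  let bp' (j : ℕ) : S.plus.carrier := ⟨pos (b j), S.plus.pos_mem _ (b j).2⟩
  let bn' (j : ℕ) : S.plus.carrier := ⟨neg (b j), S.plus.neg_mem _ (b j).2⟩
  have hsa (j : ℕ) : a j = an j + ap j := Subtype.ext (neg_part_add_pos_part _).symm
  have hsb (j : ℕ) : b j = bn' j + bp' j := Subtype.ext (neg_part_add_pos_part _).symm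
  have hu (j : ℕ) (hB : Splits S (W.B n 1 j)) :
      (⟨_, hB.1⟩ : S.minus.carrier) = an j - bn j :=
    Subtype.ext ((congrArg neg (hab j)).trans (neg_part_sub _ _))
  have hv (j : ℕ) (hB : Splits S (W.B n 1 j)) :
      (⟨_, hB.2⟩ : S.plus.carrier) = ap' j - bp' j :=
    Subtype.ext ((congrArg pos (hab j)).trans (pos_part_sub _ _))
  -- The last bracket is the remainder `[ap l + bn l, ap k + bn k]`, built only from parts common to
  -- both rings; `plusSide` contains it with the opposite sign.
  have minusSide : -((an l - bn l) * a k - a k * (an l - bn l)) +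
      ((an k - bn k) * a l - a l * (an k - bn k)) =
      (an k - bn k) * (an l - bn l) - (an l - bn l) * (an k - bn k) +
        ((k : ℤ) - l) • a (k + l - 1) +
        ((ap l * ap k - ap k * ap l) + (bn l * ap k - ap k * bn l) +
          (ap l * bn k - bn k * ap l) + (bn l * bn k - bn k * bn l)) := by
    rw [← neg_sub (l : ℤ) k, neg_smul, ← ha, hsa l, hsa k]
    noncomm_ring
  have plusSide : -((ap' l - bp' l) * b k - b k * (ap' l - bp' l)) +
      ((ap' k - bp' k) * b l - b l * (ap' k - bp' k)) =
      -((ap' k - bp' k) * (ap' l - bp' l) - (ap' l - bp' l) * (ap' k - bp' k)) -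
        ((k : ℤ) - l) • b (k + l - 1) -
        ((ap' l * ap' k - ap' k * ap' l) + (bn' l * ap' k - ap' k * bn' l) +
          (ap' l * bn' k - bn' k * ap' l) + (bn' l * bn' k - bn' k * bn' l)) := by
    rw [← neg_sub (l : ℤ) k, neg_smul, ← hb, hsb l, hsb k]
    noncomm_ring
  rw [← hu l hB₁, ← hu k hB₂] at minusSide
  rw [← hv l hB₁, ← hv k hB₂] at plusSide
  have hm := congrArg Subtype.val minusSide
  have hp := congrArg Subtype.val plusSide
  simp only [AddSubgroup.coe_add, AddSubgroup.coe_sub, AddSubgroup.coe_neg, AddSubgroup.coe_zsmul,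
    OperatorRing.coe_mul] at hm hp
  have hl : act δ₁ (W.B n 1 k) - act δ₂ (W.B n 1 l) =
      (act δ₁ (a k) - act δ₂ (a l)) - (act δ₁ (b k) - act δ₂ (b l)) := by
    rw [hab, hab, act_sub, act_sub]; abel
  rw [ZeroCurvature, hl, act_a h₁ hB₁, act_a h₂ hB₂, act_b h₁ hB₁, act_b h₂ hB₂]
  rw [hab (k + l - 1), smul_sub]
  simp only [comm, AddSubgroup.coe_sub, AddSubgroup.coe_neg, OperatorRing.coe_mul]
  have hap (j : ℕ) : (ap j : Op A) = ap' j := rfl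
  have hbn (j : ℕ) : (bn j : Op A) = bn' j := rfl
  simp only [hap, hbn] at hm
  linear_combination hm + hp

/-- The zero-curvature equation when mixed products are defined. -/
lemma zeroCurvature_mixed (hn : n ≠ 0) (hW : W.SolvesDS n) {R : OperatorRing S.D}
    (hΛ : W.Lax n ∈ R.carrier) (hM : W.M n ∈ R.carrier) (hMh : W.Mh ∈ R.carrier)
    (hm : 1 ≤ m) (hs : 1 ≤ s)
    (h₁ : W.IsBlockFlow n m l δ₁) (h₂ : W.IsBlockFlow n s k δ₂)
    (hB₁ : Splits S (W.B n m l)) (hB₂ : Splits S (W.B n s k)) :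
    ZeroCurvature S.D δ₁ δ₂ (W.B n m l) (W.B n s k) (W.B n (m + s - 1) (k + l - 1))
      ((k : ℤ) * m - s * l) := by
  let Λ : R.carrier := ⟨W.Lax n, hΛ⟩
  let μ : R.carrier := ⟨W.M n, hM⟩
  let g : R.carrier := ⟨W.Mh, hMh⟩
  let ν : R.carrier := μ - g
  let b (i j : ℕ) : R.carrier := ν ^ i * Λ ^ j
  have hb (i j : ℕ) : W.B n i j = b i j := by
    rw [OperatorRing.coe_mul, OperatorRing.coe_pow, OperatorRing.coe_pow]; rfl
  have hμ : Λ * μ - μ * Λ = 1 := Subtype.ext (comm_Lax_M hn hW)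
  have hg : Λ * g - g * Λ = 1 := Subtype.ext (comm_Lax_Mh hW)
  have hc : Commute ν Λ := by
    have : Λ * ν - ν * Λ = (Λ * μ - μ * Λ) - (Λ * g - g * Λ) := by simp only [ν]; noncomm_ring
    rw [hμ, hg, sub_self, sub_eq_zero] at this
    exact this.symm
  have hcb (i j i' j' : ℕ) : Commute (b i j) (b i' j') :=
    ((Commute.pow_pow_self ν i i').mul_right (hc.pow_pow i j')).mul_left
      ((hc.symm.pow_pow j i').mul_right (Commute.pow_pow_self Λ j j'))
  let bn (i j : ℕ) : R.carrier := ⟨neg (W.B n i j), R.neg_mem _ (hb i j ▸ (b i j).2)⟩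
  let bp (i j : ℕ) : R.carrier := ⟨pos (W.B n i j), R.pos_mem _ (hb i j ▸ (b i j).2)⟩
  have hsplit (i j : ℕ) : b i j = bn i j + bp i j :=
    Subtype.ext ((hb i j).symm.trans (neg_part_add_pos_part _).symm)
  have act_b {δ : Derivation ℚ A A} {i j : ℕ} (hδ : W.IsBlockFlow n i j δ)
      (hB : Splits S (W.B n i j)) (p q : ℕ) :
      act δ (b p q) = (-(bn i j * b p q - b p q * bn i j) -
        powDeriv ν (b i j * g - g * b i j) p * Λ ^ q : R.carrier) := by
    let u := bn i j
    have e₁ : act δ Λ = (Λ * u - u * Λ : R.carrier) := by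
      have : Λ * u - u * Λ = (-u) * Λ - Λ * (-u) := by noncomm_ring
      rw [this]
      exact act_Lax hδ hB
    have e₂ : act δ ν =
        ((ν * u - u * ν) + -(b i j * g - g * b i j) : R.carrier) := by
      -- Writing `B₊ = B - B₋` in the evolution of 𝓜̂ lets `ν` evolve by one inner derivation, at
      -- the cost of `-[B, 𝓜̂]`.
      have : (ν * u - u * ν) + -(b i j * g - g * b i j) =
          ((-u) * μ - μ * (-u)) - (bp i j * g - g * bp i j) := by
        rw [hsplit]; simp only [ν, u]; noncomm_ring
      rw [this]
      have e₃ : act δ (W.M n - W.Mh) = _ := act_sub δ _ _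
      rw [act_M hW hδ hB, act_Mh hW hδ hB] at e₃
      exact e₃
    have := OperatorRing.act_mul hδ.continuous hδ.comm_D
      (OperatorRing.act_pow hδ.continuous hδ.comm_D e₂ p)
      (OperatorRing.act_pow hδ.continuous hδ.comm_D e₁ q)
    rw [this]
    congr 1
    rw [powDeriv_add, powDeriv_neg, powDeriv_commutator, powDeriv_commutator]
    simp only [b, u]
    noncomm_ring
  have key : (-(bn m l * b s k - b s k * bn m l) -
        powDeriv ν (b m l * g - g * b m l) s * Λ ^ k) -
      (-(bn s k * b m l - b m l * bn s k) -
        powDeriv ν (b s k * g - g * b s k) m * Λ ^ l) =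
      (bn s k * bn m l - bn m l * bn s k) - (bp s k * bp m l - bp m l * bp s k) +
        ((k : ℤ) * m - s * l) • b (m + s - 1) (k + l - 1) := by
    have e₁ := powDeriv_block hc hg hs l k (m := m)
    have e₂ := powDeriv_block hc hg hm k l (m := s)
    rw [powDeriv_comm, add_comm l k, add_comm s m] at e₂
    -- `[B₂, B₁] = 0`, expanded in parts, trades the mixed brackets for `[B₂₋, B₁₋]` and `[B₂₊,
    -- B₁₊]`.
    have e₃ : (bn s k + bp s k) * (bn m l + bp m l) - (bn m l + bp m l) * (bn s k + bp s k) = 0 := by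
      rw [← hsplit, ← hsplit, (hcb m l s k).eq, sub_self]
    have e₄ : ((k : ℤ) * m - s * l) • b (m + s - 1) (k + l - 1) =
        (m * k) • b (m + s - 1) (k + l - 1) - (s * l) • b (m + s - 1) (k + l - 1) := by
      rw [sub_smul, ← natCast_zsmul, ← natCast_zsmul]; push_cast; rw [mul_comm (k : ℤ)]
    have e₅ : powDeriv ν (b s k * g - g * b s k) m * Λ ^ l -
        powDeriv ν (b m l * g - g * b m l) s * Λ ^ k =
        ((k : ℤ) * m - s * l) • b (m + s - 1) (k + l - 1) := by
      rw [e₄]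
      simp only [b]
      rw [e₁, e₂]
      abel
    rw [← e₅, hsplit m l, hsplit s k, ← sub_eq_zero, ← e₃]
    noncomm_ring
  have hk := congrArg Subtype.val key
  rw [AddSubgroup.coe_sub, ← act_b h₁ hB₁, ← act_b h₂ hB₂, ← hb, ← hb] at hk
  rw [ZeroCurvature, hk, hb (m + s - 1)]
  rfl

lemma splits_B (hW : W.SolvesDS n) (h : m = 1 ∨ W.MixedProductsDefined n) (l : ℕ) :
    Splits S (W.B n m l) := by
  rcases h with rfl | ⟨R, hΛ, hM, hMh, hneg, hpos⟩
  · rw [B_one hW]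
    exact splits_sub
      (S.minus.mul_mem _ (M_mem_minus hW) _ (OperatorRing.pow_mem (Lax_mem_minus W n) l))
      (S.plus.mul_mem _ (Mh_mem_plus hW) _ (OperatorRing.pow_mem (Lax_mem_plus hW) l))
  · have hB : W.B n m l ∈ R.carrier :=
      R.mul_mem _ (OperatorRing.pow_mem (sub_mem hM hMh) m) _ (OperatorRing.pow_mem hΛ l)
    exact ⟨hneg _ hB, hpos _ hB⟩

lemma zeroCurvature (hn : n ≠ 0) (hW : W.SolvesDS n) (hm : Odd m) (hs : Odd s)
    (hmix : (m = 1 ∧ s = 1) ∨ W.MixedProductsDefined n)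
    (h₁ : W.IsBlockFlow n m l δ₁) (h₂ : W.IsBlockFlow n s k δ₂) :
    ZeroCurvature S.D δ₁ δ₂ (W.B n m l) (W.B n s k) (W.B n (m + s - 1) (k + l - 1))
      ((k : ℤ) * m - s * l) := by
  have hB₁ := splits_B hW (hmix.imp_left And.left) l
  have hB₂ := splits_B hW (hmix.imp_left And.right) k
  rcases hmix with ⟨rfl, rfl⟩ | ⟨R, hΛ, hM, hMh, -, -⟩
  · simpa using zeroCurvature_linear hn hW h₁ h₂ hB₁ hB₂
  · exact zeroCurvature_mixed hn hW hΛ hM hMh hm.pos hs.pos h₁ h₂ hB₁ hB₂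

/-- A continuous derivation that commutes with `D` and annihilates `Φ` annihilates `𝓛`. -/
lemma act_Lax_eq_zero {δ : Derivation ℚ A A} (hc : Continuous δ)
    (hD : ∀ f, δ (S.D f) = S.D (δ f)) (hδ : ∀ P ∈ S.minus.carrier, act δ P ∈ S.minus.carrier)
    (hΦ : act δ W.Φ = 0) : act δ (W.Lax n) = 0 := by
  have h0 (P : Op A) (hP : P ∈ S.minus.carrier) : mul S.D 0 P = 0 :=
    congrArg Subtype.val (zero_mul (⟨P, hP⟩ : S.minus.carrier))
  have h0' (P : Op A) (hP : P ∈ S.minus.carrier) : mul S.D P 0 = 0 :=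
    congrArg Subtype.val (mul_zero (⟨P, hP⟩ : S.minus.carrier))
  have h := OperatorRing.act_conj hc hD hδ W.Φ_mem W.Φinv_mem S.minus.carrier.zero_mem
    (S.minus.dpow_mem (2 * n)) W.Φ_mul_inv W.Φ_inv_mul (by rw [hΦ, h0 _ W.Φ_mem]) (act_dpow _ _)
  rw [← Lax_eq_conj, comm, h0 _ (Lax_mem_minus W n), h0' _ (Lax_mem_minus W n), sub_zero] at h
  exact h

lemma commutator_Lax {δ₃ : Derivation ℚ A A}
    (h₁ : W.IsBlockFlow n m l δ₁) (h₂ : W.IsBlockFlow n s k δ₂)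
    (h₃ : c = 0 ∨ W.IsBlockFlow n m' l' δ₃)
    (h : act δ₁ (act δ₂ W.Φ) - act δ₂ (act δ₁ W.Φ) = c • act δ₃ W.Φ) :
    act δ₁ (act δ₂ (W.Lax n)) - act δ₂ (act δ₁ (W.Lax n)) = c • act δ₃ (W.Lax n) := by
  -- `Δ` inherits continuity, commutation with `D` and stability of `minus` from the flows; for `c =
  -- 0` the derivation `δ₃` may be arbitrary.
  let Δ : Derivation ℚ A A := ⁅δ₁, δ₂⁆ - c • δ₃
  have hΔ (f : A) : Δ f = δ₁ (δ₂ f) - δ₂ (δ₁ f) - c • δ₃ f := by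
    simp [Δ, Derivation.commutator_apply]
  have hact (P : Op A) :
      act Δ P = act δ₁ (act δ₂ P) - act δ₂ (act δ₁ P) - c • act δ₃ P := by
    ext i
    exact hΔ _
  have hcont : Continuous fun f => c • δ₃ f := by
    rcases h₃ with rfl | h₃
    · simpa using continuous_const
    · exact h₃.continuous.zsmul c
  have hcomm (f : A) : c • δ₃ (S.D f) = S.D (c • δ₃ f) := by
    rcases h₃ with rfl | h₃
    · simp
    · rw [h₃.comm_D, map_zsmul]
  have hmem (P : Op A) (hP : P ∈ S.minus.carrier) : c • act δ₃ P ∈ S.minus.carrier := by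
    rcases h₃ with rfl | h₃
    · simp
    · exact zsmul_mem (h₃.act_minus P hP) c
  rw [← sub_eq_zero, ← hact]
  apply act_Lax_eq_zero
  · rw [show (Δ : A → A) = _ from funext hΔ]
    exact ((h₁.continuous.comp h₂.continuous).sub (h₂.continuous.comp h₁.continuous)).sub hcont
  · intro f
    rw [hΔ, hΔ, hcomm, h₁.comm_D, h₂.comm_D, h₁.comm_D, h₂.comm_D, map_sub, map_sub]
  · intro P hP
    rw [hact]
    exact sub_mem (sub_mem (h₁.act_minus _ (h₂.act_minus _ hP))
      (h₂.act_minus _ (h₁.act_minus _ hP))) (hmem P hP)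
  · rw [hact, h, sub_self]

end Commutator

end Dressing

end Hierarchy

end DrinfeldSokolov

end

open DrinfeldSokolov in
theorem mainTheorem1 {A : Type*} [CommRing A] [Algebra ℚ A] [TopologicalSpace A]
    [IsTopologicalRing A] [T2Space A]
    (S : Setting A) (W : Dressing S) (n : ℕ) (hn : 2 ≤ n) (hW : W.SolvesDS n)
    (m s l k : ℕ) (hm : Odd m) (hs : Odd s)
    (hmix : (m = 1 ∧ s = 1) ∨ W.MixedProductsDefined n)
    (dc : ℕ → ℕ → Derivation ℚ A A)
    (hml : W.IsBlockFlow n m l (dc m l))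
    (hsk : W.IsBlockFlow n s k (dc s k))
    (hsum : 1 ≤ k + l → W.IsBlockFlow n (m + s - 1) (k + l - 1) (dc (m + s - 1) (k + l - 1))) :
    act (dc m l) (W.Lax n) = comm S.D (-neg (W.B n m l)) (W.Lax n) ∧
    ∀ X : Op A, X = W.Φ ∨ X = W.Φh ∨ X = W.Lax n →
      act (dc m l) (act (dc s k) X) - act (dc s k) (act (dc m l) X) =
        ((k : ℤ) * m - s * l) • act (dc (m + s - 1) (k + l - 1)) X := by
  have hB₁ := Dressing.splits_B hW (hmix.imp_left And.left) l
  have hB₂ := Dressing.splits_B hW (hmix.imp_left And.right) k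
  have hB₃ : Dressing.Splits S (W.B n (m + s - 1) (k + l - 1)) :=
    Dressing.splits_B hW (hmix.imp_left fun h => by omega) _
  have hzc := Dressing.zeroCurvature (by omega) hW hm hs hmix hml hsk
  have h₃ : (k : ℤ) * m - s * l = 0 ∨
      W.IsBlockFlow n (m + s - 1) (k + l - 1) (dc (m + s - 1) (k + l - 1)) := by
    -- For `k = l = 0` the index `k + l - 1` is truncated, but the coefficient is zero and no third
    -- flow is required.
    rcases Nat.eq_zero_or_pos (k + l) with h | h
    · left
      obtain ⟨rfl, rfl⟩ : k = 0 ∧ l = 0 := by omega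
      simp
    · exact Or.inr (hsum h)
  have hΦ : act (dc m l) (act (dc s k) W.Φ) - act (dc s k) (act (dc m l) W.Φ) =
      ((k : ℤ) * m - s * l) • act (dc (m + s - 1) (k + l - 1)) W.Φ := by
    rw [Dressing.commutator_Φ hml hsk hB₁ hB₂ hB₃ hzc]
    rcases h₃ with h | h
    · rw [h, zero_smul, zero_smul]
    · rw [h.act_Φ]
  refine ⟨Dressing.act_Lax hml hB₁, ?_⟩
  rintro X (rfl | rfl | rfl)
  · exact hΦ
  · rw [Dressing.commutator_Φh hml hsk hB₁ hB₂ hB₃ hzc]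
    rcases h₃ with h | h
    · rw [h, zero_smul, zero_smul]
    · rw [h.act_Φh]
  · exact Dressing.commutator_Lax hml hsk h₃ hΦ
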